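/- Let $G$ be a group, $S\subseteq G$, and let $G^+$ be the submonoid generated by $S$. Write $a\preceq b$ if $b=ac$ with $c\in G^+$, $b\succeq a$ if $b=ca$ with $c\in G^+$, and $a\le b$ if $b=cac'$ with $c,c'\in G^+$. Let $\wedge$ and $\tilde\wedge$ be the greatest common left and right divisor in $G^+$, and $\vee$ the least common right multiple. Assume that $(G,S)$ is a Garside system with Garside element $\Delta$: every $a\in G^+$ admits a bound on the number of factors $\neq 1$ in its factorizations in $G^+$, any two elements of $G^+$ have a least common right and a least common left multiple in $G^+$, $G$ is the group of fractions of $G^+$, and $S$ is finite, generates $G$, and is both the set of left divisors and the set of right divisors of $\Delta\in G^+$ in $G^+$. Assume that it is of spindle type: $a\wedge b$ and $a\,\tilde\wedge\, b$ lie in $\{a,b,1\}$ for all $a,b\in S$. Put $\tau(a)=\Delta^{-1}a\Delta$, and for $a\in S$ let $\partial(a)$ be the element with $a\vee\Delta=a\,\partial(a)$. Let $\inf(a)$ be the maximal $r\in\mathbb{Z}$ with $\Delta^r\le a$ and $\sup(a)$ the minimal $s\in\mathbb{Z}$ with $a\le\Delta^s$. Let $\inf_s(b)$ be the maximum of $\inf$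 and $\sup_s(b)$ the minimum of $\sup$ on the conjugacy class of $b$, and let the super summit set $SSS(b)$ be the set of the conjugates $a$ of $b$ with $\Delta^{\inf_s(b)}\preceq a\preceq\Delta^{\sup_s(b)}$. Let $b\in G$ have left normal form $b=\Delta^p s_1\cdots s_l$ with $l\ge 1$, that is, $p=\inf(b)$, $s_i=\Delta\wedge(s_i\cdots s_l)$ for $1\le i\le l$, and $s_l\ne 1$. Call $b$ rigid if $\tau^{-p}(s_1)\wedge\partial(s_l)=1$, and let $d(b)=\Delta^p\,\tau^p(s_l)\,s_1\cdots s_{l-1}$ be its decycling. (i) If $b$ is rigid, then $b\in SSS(b)$. (ii) If $l\ge 2$, then $b\in SSS(b)$ if and only if $b$ is rigid. (iii) If $l\ge 2$ and $b$ is not rigid, then $\inf(d(b))=\inf(b)+1$ or $\sup(d(b))=\sup(b)-1$. -/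

import Mathlib

namespace Garside

variable {G : Type*} [Group G]

/-! Divisibility, lcm's and gcd's with respect to a submonoid `P` of a group `G`.
For elements of `P` these are the notions of the monoid `P`. -/

/-- `a ≼ b`: `a` is a left divisor of `b`. -/
def LDvd (P : Submonoid G) (a b : G) : Prop := ∃ c ∈ P, b = a * c

/-- `b ≽ a`: `a` is a right divisor of `b`. -/
def RDvd (P : Submonoid G) (a b : G) : Prop := ∃ c ∈ P, b = c * a

/-- `a ≤ b`: one has `b = c * a * c'` with `c, c'` in `P`. -/
def Le (P : Submonoid G) (a b : G) : Prop := ∃ c ∈ P, ∃ c' ∈ P, b = c * a * c'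

/-- `m = a ∨ b` is the right lcm of `a` and `b` in `P`. -/
def IsRightLcm (P : Submonoid G) (a b m : G) : Prop :=
  m ∈ P ∧ LDvd P a m ∧ LDvd P b m ∧
    ∀ c ∈ P, LDvd P a c → LDvd P b c → LDvd P m c

/-- `m` is the left lcm of `a` and `b` in `P`. -/
def IsLeftLcm (P : Submonoid G) (a b m : G) : Prop :=
  m ∈ P ∧ RDvd P a m ∧ RDvd P b m ∧
    ∀ c ∈ P, RDvd P a c → RDvd P b c → RDvd P m c

/-- `d = a ∧ b` is the greatest common left divisor of `a` and `b` in `P`. -/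
def IsLeftGcd (P : Submonoid G) (a b d : G) : Prop :=
  d ∈ P ∧ LDvd P d a ∧ LDvd P d b ∧
    ∀ c ∈ P, LDvd P c a → LDvd P c b → LDvd P c d

/-- `d` is the greatest common right divisor of `a` and `b` in `P`. -/
def IsRightGcd (P : Submonoid G) (a b d : G) : Prop :=
  d ∈ P ∧ RDvd P d a ∧ RDvd P d b ∧
    ∀ c ∈ P, RDvd P c a → RDvd P c b → RDvd P c d

/-- `P` is an lcm monoid: Noetherian, cancellative, with right and left lcm's.
Cancellativity is automatic, because `P` lies in a group. -/
structure IsLcmMonoid (P : Submonoid G) : Prop where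
  noetherian : ∀ a ∈ P, ∃ n : ℕ, ∀ L : List G,
    (∀ x ∈ L, x ∈ P ∧ x ≠ 1) → L.prod = a → L.length ≤ n
  exists_rightLcm : ∀ a ∈ P, ∀ b ∈ P, ∃ m, IsRightLcm P a b m
  exists_leftLcm : ∀ a ∈ P, ∀ b ∈ P, ∃ m, IsLeftLcm P a b m

/-- The monoid `G⁺` generated by `S`. -/
abbrev pos (S : Set G) : Submonoid G := Submonoid.closure S

/-- `(G, S)` is a Garside system with Garside element `Δ`, so `S = Div(Δ)`. -/
structure IsGarsideSystem (S : Set G) (Δ : G) : Prop where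
  isLcmMonoid : IsLcmMonoid (pos S)
  /-- `G` is the group of (left and right) fractions of `G⁺`. -/
  fractions : ∀ g : G, (∃ a ∈ pos S, ∃ b ∈ pos S, g = a⁻¹ * b) ∧
    (∃ a ∈ pos S, ∃ b ∈ pos S, g = a * b⁻¹)
  delta_mem : Δ ∈ pos S
  eq_leftDivisors : S = {a | a ∈ pos S ∧ LDvd (pos S) a Δ}
  eq_rightDivisors : S = {a | a ∈ pos S ∧ RDvd (pos S) a Δ}
  finite : S.Finite
  generates : Subgroup.closure S = ⊤

/-- `(G, S)` is a Garside system of spindle type with Garside element `Δ`. -/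
structure IsSpindle (S : Set G) (Δ : G) : Prop extends IsGarsideSystem S Δ where
  leftGcd : ∀ a ∈ S, ∀ b ∈ S, ∀ d, IsLeftGcd (pos S) a b d → d = a ∨ d = b ∨ d = 1
  rightGcd : ∀ a ∈ S, ∀ b ∈ S, ∀ d, IsRightGcd (pos S) a b d → d = a ∨ d = b ∨ d = 1

/-- The right complement `a \ b`: the element `c` of `P` with `a ∨ b = a * c`. -/
noncomputable def rightComplement (P : Submonoid G) (a b : G) : G :=
  Classical.epsilon fun c => c ∈ P ∧ IsRightLcm P a b (a * c)

/-- `∂ a = a \ Δ`. -/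
noncomputable def partialMap (S : Set G) (Δ a : G) : G := rightComplement (pos S) a Δ

/-- The inner automorphism `τ : a ↦ Δ⁻¹ * a * Δ`. -/
def tau (Δ : G) : MulAut G := MulAut.conj Δ⁻¹

/-- `inf a = r`: `r` is the maximal integer with `Δ ^ r ≤ a`. -/
def IsInf (S : Set G) (Δ a : G) (r : ℤ) : Prop :=
  IsGreatest {k : ℤ | Le (pos S) (Δ ^ k) a} r

/-- `sup a = r`: `r` is the minimal integer with `a ≤ Δ ^ r`. -/
def IsSup (S : Set G) (Δ a : G) (r : ℤ) : Prop :=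
  IsLeast {k : ℤ | Le (pos S) a (Δ ^ k)} r

/-- `inf_s b = r`: `r` is the maximal infimum in the conjugacy class of `b`. -/
def IsSummitInf (S : Set G) (Δ b : G) (r : ℤ) : Prop :=
  IsGreatest {k : ℤ | ∃ b', IsConj b b' ∧ IsInf S Δ b' k} r

/-- `sup_s b = r`: `r` is the minimal supremum in the conjugacy class of `b`. -/
def IsSummitSup (S : Set G) (Δ b : G) (r : ℤ) : Prop :=
  IsLeast {k : ℤ | ∃ b', IsConj b b' ∧ IsSup S Δ b' k} r

/-- The super summit set of `b`: the conjugates `a` of `b` with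
`Δ ^ inf_s b ≼ a ≼ Δ ^ sup_s b`. -/
def superSummitSet (S : Set G) (Δ b : G) : Set G :=
  {a | IsConj b a ∧ ∃ r s : ℤ, IsSummitInf S Δ b r ∧ IsSummitSup S Δ b s ∧
    LDvd (pos S) (Δ ^ r) a ∧ LDvd (pos S) a (Δ ^ s)}

/-- The list `s₁, …, s_l` is a left normal form of a positive element (its product):
`s_i = Δ ∧ (s_i ⋯ s_l)` for every `i`, and `s_l ≠ 1`. -/
def IsPositiveNormalForm (S : Set G) (Δ : G) (L : List G) : Prop :=
  (∀ s t, (s :: t) <:+ L → IsLeftGcd (pos S) Δ (s :: t).prod s) ∧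
    ∀ h : L ≠ [], L.getLast h ≠ 1

/-- `b = Δ ^ p * s₁ ⋯ s_l` is the left (`Δ`-)normal form of `b`, where `L = [s₁, …, s_l]`:
`p = inf b`, and `s₁, …, s_l` is the left normal form of `Δ ^ (-p) * b`. -/
def IsLeftNormalForm (S : Set G) (Δ b : G) (p : ℤ) (L : List G) : Prop :=
  IsInf S Δ b p ∧ b = Δ ^ p * L.prod ∧ IsPositiveNormalForm S Δ L

/-- The rigidity condition `τ ^ (-p) (s₁) ∧ ∂ (s_l) = 1` for an element with left normal form
`Δ ^ p * s₁ ⋯ s_l`, where `L = [s₁, …, s_l]` and `l ≥ 1`. -/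
def IsRigid (S : Set G) (Δ : G) (p : ℤ) (L : List G) (hL : L ≠ []) : Prop :=
  IsLeftGcd (pos S) ((tau Δ ^ (-p)) (L.head hL)) (partialMap S Δ (L.getLast hL)) 1

/-- The decycling `Δ ^ p * τ ^ p (s_l) * s₁ ⋯ s_{l-1}` of the element with left normal form
`Δ ^ p * s₁ ⋯ s_l`, where `L = [s₁, …, s_l]` and `l ≥ 1`. -/
def decycle (Δ : G) (p : ℤ) (L : List G) (hL : L ≠ []) : G :=
  Δ ^ p * (tau Δ ^ p) (L.getLast hL) * L.dropLast.prod

end Garside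

namespace Garside

variable {G : Type*} [Group G] {S : Set G} {Δ : G}

/-! Rigidity says that consecutive factors stay left weighted when the normal form of `b` is
followed by another copy of itself, shifted by `τ ^ (-p)`. Left weightedness is local and controls
all simple left divisors of a product (`isHead_mul`), so no power `b ^ n` is divisible by `Δ ^ (n *
p + 1)` (`pow_inf`). Complements `s⁻¹ * Δ` give the same control over `b⁻¹`, hence over suprema
(`pow_sup`). A conjugate with larger infimum or smaller supremum would gain at least `n` in its
`n`-th power, whereas conjugation costs a bounded amount independent of `n` (`le_of_isConj_of_pow`).
Hence a rigid element lies in its super summit set.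

If `b` is not rigid, the gcd of `τ ^ (-p) (s₁)` and `∂ s_l` is not `1`, so in spindle type one of
the two divides the other. Then the product `s_l * τ ^ (-p) (s₁)` formed by decycling is either
simple or divisible by `Δ`: the supremum drops or the infimum rises (`inf_or_sup_decycle`).
Decycling is a conjugation, so `b` is not in its super summit set. -/

/-- Every left divisor of `x` in `S` is a left divisor of `s`. -/
def IsHead (S : Set G) (x s : G) : Prop :=
  ∀ c ∈ S, LDvd (pos S) c x → LDvd (pos S) c s

/-- The simple elements `s`, `t` are left weighted: `s⁻¹ * Δ` and `t` are left coprime. -/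
def LeftWeighted (S : Set G) (Δ s t : G) : Prop :=
  ∀ c ∈ pos S, LDvd (pos S) c (s⁻¹ * Δ) → LDvd (pos S) c t → c = 1

/-! ### Divisibility in a submonoid of a group. -/

theorem mem_pos {a : G} (ha : a ∈ S) : a ∈ pos S := Submonoid.subset_closure ha

theorem prod_mem_pos {L : List G} (hL : ∀ s ∈ L, s ∈ S) : L.prod ∈ pos S :=
  list_prod_mem fun s hs => mem_pos (hL s hs)

theorem ldvd_iff {P : Submonoid G} {a b : G} : LDvd P a b ↔ a⁻¹ * b ∈ P := by
  constructor
  · rintro ⟨c, hc, rfl⟩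
    simpa using hc
  · exact fun h => ⟨_, h, by group⟩

theorem rdvd_iff {P : Submonoid G} {a b : G} : RDvd P a b ↔ b * a⁻¹ ∈ P := by
  constructor
  · rintro ⟨c, hc, rfl⟩
    simpa using hc
  · exact fun h => ⟨_, h, by group⟩

theorem ldvd_trans {P : Submonoid G} {a b c : G} (hab : LDvd P a b) (hbc : LDvd P b c) :
    LDvd P a c := by
  rw [ldvd_iff] at *
  have := mul_mem hab hbc
  rwa [show a⁻¹ * b * (b⁻¹ * c) = a⁻¹ * c by group] at this

theorem ldvd_mul_left_iff {P : Submonoid G} {a b c : G} :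
    LDvd P (c * a) (c * b) ↔ LDvd P a b := by
  rw [ldvd_iff, ldvd_iff, show (c * a)⁻¹ * (c * b) = a⁻¹ * b by group]

theorem tau_zpow_apply (Δ x : G) (k : ℤ) : (tau Δ ^ k) x = Δ ^ (-k) * x * Δ ^ k := by
  rw [tau, ← map_zpow, MulAut.conj_apply, inv_zpow', ← zpow_neg, neg_neg]

namespace IsLcmMonoid

/-- A nontrivial unit would give arbitrarily long factorizations of `1`, against Noetherianity. -/
theorem eq_one {P : Submonoid G} (hP : IsLcmMonoid P) {x : G} (hx : x ∈ P) (hx' : x⁻¹ ∈ P) :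
    x = 1 := by
  by_contra h
  obtain ⟨n, hn⟩ := hP.noetherian 1 P.one_mem
  have := hn (List.replicate (n + 1) x ++ List.replicate (n + 1) x⁻¹) (by
    intro y hy
    rw [List.mem_append] at hy
    rcases hy with hy | hy
    · rw [List.eq_of_mem_replicate hy]
      exact ⟨hx, h⟩
    · rw [List.eq_of_mem_replicate hy]
      exact ⟨hx', inv_ne_one.2 h⟩) (by simp)
  simp at this
  omega

theorem eq_one_of_ldvd {P : Submonoid G} (hP : IsLcmMonoid P) {x : G} (hx : x ∈ P)
    (h : LDvd P x 1) : x = 1 :=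
  hP.eq_one hx (by simpa [ldvd_iff] using h)

theorem ldvd_antisymm {P : Submonoid G} (hP : IsLcmMonoid P) {a b : G} (hab : LDvd P a b)
    (hba : LDvd P b a) : a = b := by
  rw [ldvd_iff] at hab hba
  exact inv_mul_eq_one.1 (hP.eq_one hab (by simpa using hba))

end IsLcmMonoid

/-! ### Simple elements, conjugation by `Δ`, infimum and supremum. -/

namespace IsGarsideSystem

variable (hS : IsGarsideSystem S Δ)
include hS

theorem mem_iff_left {a : G} : a ∈ S ↔ a ∈ pos S ∧ a⁻¹ * Δ ∈ pos S := by
  rw [← ldvd_iff]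
  exact Set.ext_iff.1 hS.eq_leftDivisors a

theorem mem_iff_right {a : G} : a ∈ S ↔ a ∈ pos S ∧ Δ * a⁻¹ ∈ pos S := by
  rw [← rdvd_iff]
  exact Set.ext_iff.1 hS.eq_rightDivisors a

theorem delta_mem_self : Δ ∈ S := hS.mem_iff_left.2 ⟨hS.delta_mem, by simp⟩

theorem mem_of_ldvd {a b : G} (ha : a ∈ pos S) (hb : b ∈ S) (h : LDvd (pos S) a b) : a ∈ S :=
  hS.mem_iff_left.2 ⟨ha, ldvd_iff.1 (ldvd_trans h (ldvd_iff.2 (hS.mem_iff_left.1 hb).2))⟩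

theorem compl_mem {a : G} (ha : a ∈ S) : a⁻¹ * Δ ∈ S :=
  hS.mem_iff_right.2 ⟨(hS.mem_iff_left.1 ha).2, by simpa using mem_pos ha⟩

theorem leftCompl_mem {a : G} (ha : a ∈ S) : Δ * a⁻¹ ∈ S :=
  hS.mem_iff_left.2 ⟨(hS.mem_iff_right.1 ha).2, by simpa using mem_pos ha⟩

/-- Taking the complement `a ↦ a⁻¹ * Δ` twice is conjugation by `Δ`, so `S` is preserved. -/
theorem conj_mem {x : G} (hx : x ∈ pos S) : Δ⁻¹ * x * Δ ∈ pos S := by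
  induction hx using Submonoid.closure_induction with
  | mem x hx =>
    have := mem_pos (hS.compl_mem (hS.compl_mem hx))
    rwa [show (x⁻¹ * Δ)⁻¹ * Δ = Δ⁻¹ * x * Δ by group] at this
  | one => simp
  | mul x y _ _ h₁ h₂ =>
    rw [show Δ⁻¹ * (x * y) * Δ = (Δ⁻¹ * x * Δ) * (Δ⁻¹ * y * Δ) by group]
    exact mul_mem h₁ h₂

theorem conj_inv_mem {x : G} (hx : x ∈ pos S) : Δ * x * Δ⁻¹ ∈ pos S := by
  induction hx using Submonoid.closure_induction with
  | mem x hx =>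
    have := mem_pos (hS.leftCompl_mem (hS.leftCompl_mem hx))
    rwa [show Δ * (Δ * x⁻¹)⁻¹ = Δ * x * Δ⁻¹ by group] at this
  | one => simp
  | mul x y _ _ h₁ h₂ =>
    rw [show Δ * (x * y) * Δ⁻¹ = (Δ * x * Δ⁻¹) * (Δ * y * Δ⁻¹) by group]
    exact mul_mem h₁ h₂

theorem zpow_conj_mem (k : ℤ) {x : G} (hx : x ∈ pos S) : Δ ^ (-k) * x * Δ ^ k ∈ pos S := by
  induction k with
  | zero => simpa using hx
  | succ n ih =>
    have := hS.conj_mem ih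
    rwa [show Δ⁻¹ * (Δ ^ (-(n : ℤ)) * x * Δ ^ (n : ℤ)) * Δ
      = Δ ^ (-((n : ℤ) + 1)) * x * Δ ^ ((n : ℤ) + 1) by group] at this
  | pred n ih =>
    have := hS.conj_inv_mem ih
    rwa [show Δ * (Δ ^ (-(-(n : ℤ))) * x * Δ ^ (-(n : ℤ))) * Δ⁻¹
      = Δ ^ (-(-(n : ℤ) - 1)) * x * Δ ^ (-(n : ℤ) - 1) by group] at this

theorem zpow_conj_mem_iff (k : ℤ) {x : G} : Δ ^ (-k) * x * Δ ^ k ∈ pos S ↔ x ∈ pos S := by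
  refine ⟨fun h => ?_, hS.zpow_conj_mem k⟩
  have := hS.zpow_conj_mem (-k) h
  rwa [show Δ ^ (- -k) * (Δ ^ (-k) * x * Δ ^ k) * Δ ^ (-k) = x by group] at this

theorem zpow_conj_mem_self (k : ℤ) {x : G} (hx : x ∈ S) : Δ ^ (-k) * x * Δ ^ k ∈ S := by
  refine hS.mem_iff_left.2 ⟨hS.zpow_conj_mem k (mem_pos hx), ?_⟩
  have := hS.zpow_conj_mem k (hS.mem_iff_left.1 hx).2
  rwa [show Δ ^ (-k) * (x⁻¹ * Δ) * Δ ^ k = (Δ ^ (-k) * x * Δ ^ k)⁻¹ * Δ by group] at this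

theorem ldvd_zpow_conj_iff (k : ℤ) {x y : G} :
    LDvd (pos S) (Δ ^ (-k) * x * Δ ^ k) (Δ ^ (-k) * y * Δ ^ k) ↔ LDvd (pos S) x y := by
  rw [ldvd_iff, ldvd_iff, ← hS.zpow_conj_mem_iff k (x := x⁻¹ * y),
    show (Δ ^ (-k) * x * Δ ^ k)⁻¹ * (Δ ^ (-k) * y * Δ ^ k)
      = Δ ^ (-k) * (x⁻¹ * y) * Δ ^ k by group]

/-- Powers of `Δ` normalize `G⁺`, so the left cofactor can be moved across `Δ ^ k`. -/
theorem le_zpow_left_iff {a : G} {k : ℤ} : Le (pos S) (Δ ^ k) a ↔ Δ ^ (-k) * a ∈ pos S := by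
  constructor
  · rintro ⟨c, hc, c', hc', rfl⟩
    rw [show Δ ^ (-k) * (c * Δ ^ k * c') = Δ ^ (-k) * c * Δ ^ k * c' by group]
    exact mul_mem (hS.zpow_conj_mem k hc) hc'
  · exact fun h => ⟨1, one_mem _, _, h, by group⟩

theorem le_zpow_right_iff {a : G} {k : ℤ} : Le (pos S) a (Δ ^ k) ↔ a⁻¹ * Δ ^ k ∈ pos S := by
  constructor
  · rintro ⟨c, hc, c', hc', h⟩
    have := mul_mem hc' (hS.zpow_conj_mem k hc)
    rwa [show c' * (Δ ^ (-k) * c * Δ ^ k) = a⁻¹ * Δ ^ k by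
      rw [show c' = (c * a)⁻¹ * Δ ^ k by rw [h]; group]; group] at this
  · exact fun h => ⟨1, one_mem _, _, h, by group⟩

theorem zpow_mem {k : ℤ} (hk : 0 ≤ k) : Δ ^ k ∈ pos S := by
  lift k to ℕ using hk
  simpa using pow_mem hS.delta_mem k

theorem zpow_neg_mul_mem_of_le {j k : ℤ} (h : j ≤ k) {a : G} (ha : Δ ^ (-k) * a ∈ pos S) :
    Δ ^ (-j) * a ∈ pos S := by
  have := mul_mem (hS.zpow_mem (sub_nonneg.2 h)) ha
  rwa [show Δ ^ (k - j) * (Δ ^ (-k) * a) = Δ ^ (-j) * a by group] at this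

theorem inv_mul_zpow_mem_of_le {j k : ℤ} (h : j ≤ k) {a : G} (ha : a⁻¹ * Δ ^ j ∈ pos S) :
    a⁻¹ * Δ ^ k ∈ pos S := by
  have := mul_mem ha (hS.zpow_mem (sub_nonneg.2 h))
  rwa [show a⁻¹ * Δ ^ j * Δ ^ (k - j) = a⁻¹ * Δ ^ k by group] at this

theorem isInf_of {a : G} {k : ℤ} (h : Δ ^ (-k) * a ∈ pos S)
    (h' : Δ ^ (-(k + 1)) * a ∉ pos S) : IsInf S Δ a k := by
  refine ⟨hS.le_zpow_left_iff.2 h, fun j hj => ?_⟩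
  by_contra! hlt
  exact h' (hS.zpow_neg_mul_mem_of_le hlt (hS.le_zpow_left_iff.1 hj))

theorem isSup_of {a : G} {k : ℤ} (h : a⁻¹ * Δ ^ k ∈ pos S)
    (h' : a⁻¹ * Δ ^ (k - 1) ∉ pos S) : IsSup S Δ a k := by
  refine ⟨hS.le_zpow_right_iff.2 h, fun j hj => ?_⟩
  by_contra! hlt
  exact h' (hS.inv_mul_zpow_mem_of_le (by omega) (hS.le_zpow_right_iff.1 hj))

theorem exists_zpow_mul_mem (x : G) : ∃ N : ℕ, Δ ^ (N : ℤ) * x ∈ pos S := by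
  obtain ⟨a, ha, b, hb, rfl⟩ := (hS.fractions x).1
  suffices h : ∃ N : ℕ, Δ ^ (N : ℤ) * a⁻¹ ∈ pos S by
    obtain ⟨N, hN⟩ := h
    exact ⟨N, by simpa [mul_assoc] using mul_mem hN hb⟩
  clear hb
  induction ha using Submonoid.closure_induction with
  | mem a ha => exact ⟨1, by simpa using (hS.mem_iff_right.1 ha).2⟩
  | one => exact ⟨0, by simp⟩
  | mul a c _ _ h₁ h₂ =>
    obtain ⟨M, hM⟩ := h₁
    obtain ⟨N, hN⟩ := h₂
    refine ⟨M + N, ?_⟩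
    have := mul_mem (hS.zpow_conj_mem (-(M : ℤ)) hN) hM
    rwa [show Δ ^ (- -(M : ℤ)) * (Δ ^ (N : ℤ) * c⁻¹) * Δ ^ (-(M : ℤ)) * (Δ ^ (M : ℤ) * a⁻¹)
      = Δ ^ ((M + N : ℕ) : ℤ) * (a * c)⁻¹ by push_cast; group] at this

theorem partialMap_eq {a : G} (ha : a ∈ S) : partialMap S Δ a = a⁻¹ * Δ := by
  have hlcm : IsRightLcm (pos S) a Δ Δ :=
    ⟨hS.delta_mem, ldvd_iff.2 (hS.mem_iff_left.1 ha).2, ldvd_iff.2 (by simp),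
      fun c _ _ h => h⟩
  have hex : ∃ c, c ∈ pos S ∧ IsRightLcm (pos S) a Δ (a * c) :=
    ⟨a⁻¹ * Δ, (hS.mem_iff_left.1 ha).2, by simpa using hlcm⟩
  obtain ⟨_, h₁, h₂, h₃, h₄⟩ := Classical.epsilon_spec hex
  exact eq_inv_mul_of_mul_eq
    (hS.isLcmMonoid.ldvd_antisymm (h₄ Δ hS.delta_mem hlcm.2.1 hlcm.2.2.1) h₃)

/-- On simple elements the complement `a ↦ a⁻¹ * Δ` turns left divisibility into reversed right
divisibility, so a left lcm of complements yields a left gcd. -/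
theorem exists_leftGcd {a b : G} (ha : a ∈ S) (hb : b ∈ S) :
    ∃ d, IsLeftGcd (pos S) a b d := by
  obtain ⟨m, hm, ham, hbm, hmin⟩ := hS.isLcmMonoid.exists_leftLcm _
    (mem_pos (hS.compl_mem ha)) _ (mem_pos (hS.compl_mem hb))
  have hmΔ : RDvd (pos S) m Δ := hmin Δ hS.delta_mem
    (rdvd_iff.2 (by simpa using mem_pos ha)) (rdvd_iff.2 (by simpa using mem_pos hb))
  rw [rdvd_iff] at ham hbm hmΔ
  refine ⟨Δ * m⁻¹, hmΔ, ?_, ?_, fun c hc hca hcb => ?_⟩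
  · rwa [ldvd_iff, show (Δ * m⁻¹)⁻¹ * a = m * (a⁻¹ * Δ)⁻¹ by group]
  · rwa [ldvd_iff, show (Δ * m⁻¹)⁻¹ * b = m * (b⁻¹ * Δ)⁻¹ by group]
  · have hcS := hS.mem_of_ldvd hc ha hca
    rw [ldvd_iff] at hca hcb
    have := hmin (c⁻¹ * Δ) (hS.mem_iff_left.1 hcS).2
      (rdvd_iff.2 (by rwa [show c⁻¹ * Δ * (a⁻¹ * Δ)⁻¹ = c⁻¹ * a by group]))
      (rdvd_iff.2 (by rwa [show c⁻¹ * Δ * (b⁻¹ * Δ)⁻¹ = c⁻¹ * b by group]))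
    rw [rdvd_iff] at this
    rwa [ldvd_iff, ← mul_assoc]

/-! ### Heads of products of left weighted factors. -/

theorem isHead_one {s : G} (hs : s ∈ pos S) : IsHead S 1 s := by
  intro c hc h
  rw [hS.isLcmMonoid.eq_one_of_ldvd (mem_pos hc) h]
  exact ldvd_iff.2 (by simpa using hs)

theorem isHead_conj (k : ℤ) {x s : G} (h : IsHead S x s) :
    IsHead S (Δ ^ (-k) * x * Δ ^ k) (Δ ^ (-k) * s * Δ ^ k) := by
  intro c hc hcx
  have e : c = Δ ^ (-k) * (Δ ^ (- -k) * c * Δ ^ (-k)) * Δ ^ k := by group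
  rw [e, hS.ldvd_zpow_conj_iff k] at hcx ⊢
  exact h _ (hS.zpow_conj_mem_self (-k) hc) hcx

theorem leftWeighted_conj (k : ℤ) {s t : G} (h : LeftWeighted S Δ s t) :
    LeftWeighted S Δ (Δ ^ (-k) * s * Δ ^ k) (Δ ^ (-k) * t * Δ ^ k) := by
  intro c hc hcs hct
  have e : c = Δ ^ (-k) * (Δ ^ (- -k) * c * Δ ^ (-k)) * Δ ^ k := by group
  rw [show (Δ ^ (-k) * s * Δ ^ k)⁻¹ * Δ = Δ ^ (-k) * (s⁻¹ * Δ) * Δ ^ k by group] at hcs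
  rw [e, hS.ldvd_zpow_conj_iff k] at hcs hct
  rw [e, h _ (hS.zpow_conj_mem (-k) hc) hcs hct]
  group

/-- Write the right lcm of `c` and `s` as `s * d`. It divides both `s * x` and `Δ`, so `d` divides
`x` and `s⁻¹ * Δ`; thus `d` is simple, divides `t`, and is `1` by weightedness. -/
theorem isHead_mul {s t x : G} (hs : s ∈ S) (hx : x ∈ pos S) (hst : LeftWeighted S Δ s t)
    (hxt : IsHead S x t) : IsHead S (s * x) s := by
  intro c hc hcx
  obtain ⟨m, hm, hcm, ⟨d, hd, rfl⟩, hmin⟩ :=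
    hS.isLcmMonoid.exists_rightLcm c (mem_pos hc) s (mem_pos hs)
  have h₁ : LDvd (pos S) d x := ldvd_mul_left_iff.1
    (hmin _ (mul_mem (mem_pos hs) hx) hcx (ldvd_iff.2 (by simpa using hx)))
  have h₂ : LDvd (pos S) d (s⁻¹ * Δ) := by
    rw [← ldvd_mul_left_iff (c := s), mul_inv_cancel_left]
    exact hmin _ hS.delta_mem (ldvd_iff.2 (hS.mem_iff_left.1 hc).2)
      (ldvd_iff.2 (hS.mem_iff_left.1 hs).2)
  rwa [hst d hd h₂ (hxt d (hS.mem_of_ldvd hd (hS.compl_mem hs) h₂) h₁), mul_one] at hcm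

theorem eq_delta_of_isHead {x s : G} (hs : s ∈ S) (hxs : IsHead S x s)
    (h : LDvd (pos S) Δ x) : s = Δ :=
  hS.isLcmMonoid.ldvd_antisymm (ldvd_iff.2 (hS.mem_iff_left.1 hs).2)
    (hxs _ hS.delta_mem_self h)

theorem isHead_prod_mul {L : List G} {s t x : G} (hL : ∀ u ∈ s :: L, u ∈ S)
    (hx : x ∈ pos S) (hc : List.IsChain (LeftWeighted S Δ) (s :: L ++ [t]))
    (hxt : IsHead S x t) : IsHead S ((s :: L).prod * x) s := by
  induction L generalizing s with
  | nil =>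
    simp only [List.cons_append, List.nil_append, List.isChain_cons_cons] at hc
    simpa using hS.isHead_mul (hL s (by simp)) hx hc.1 hxt
  | cons u L ih =>
    simp only [List.cons_append, List.isChain_cons_cons] at hc
    rw [List.prod_cons, mul_assoc]
    refine hS.isHead_mul (hL s (by simp)) ?_ hc.1 (ih (fun v hv => hL v (by simp_all)) hc.2)
    exact mul_mem (prod_mem_pos fun v hv => hL v (by simp_all)) hx

/-- Inverting a factor amounts to prepending its complement, up to a shift: `s⁻¹ * y * Δ = (s⁻¹ * Δ)
* τ y`. Weightedness of `(u, s)` becomes that of `(s⁻¹ * Δ, τ (u⁻¹ * Δ))`, the two coprime elements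
being exchanged. -/
theorem isHead_inv_mul {L : List G} {u y : G} (hu : u ∈ S) (hL : ∀ s ∈ L, s ∈ S)
    (hy : y ∈ pos S) (hc : List.IsChain (LeftWeighted S Δ) (u :: L))
    (hyu : IsHead S y (u⁻¹ * Δ)) :
    L.prod⁻¹ * y * Δ ^ (L.length : ℤ) ∈ pos S ∧
      IsHead S (L.prod⁻¹ * y * Δ ^ (L.length : ℤ))
        (((u :: L).getLast (List.cons_ne_nil _ _))⁻¹ * Δ) := by
  induction L generalizing u y with
  | nil => simpa using ⟨hy, hyu⟩
  | cons s L ih =>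
    rw [List.isChain_cons_cons] at hc
    have hs := hL s (by simp)
    have hy' : Δ⁻¹ * y * Δ ∈ pos S := hS.conj_mem hy
    have e : s⁻¹ * y * Δ = (s⁻¹ * Δ) * (Δ⁻¹ * y * Δ) := by group
    have hw : LeftWeighted S Δ (s⁻¹ * Δ) (Δ ^ (-1 : ℤ) * (u⁻¹ * Δ) * Δ ^ (1 : ℤ)) := by
      intro c hcP h₁ h₂
      rw [show (s⁻¹ * Δ)⁻¹ * Δ = Δ ^ (-1 : ℤ) * s * Δ ^ (1 : ℤ) by group] at h₁
      have e : c = Δ ^ (-1 : ℤ) * (Δ ^ (- -1 : ℤ) * c * Δ ^ (-1 : ℤ)) * Δ ^ (1 : ℤ) := by group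
      rw [e, hS.ldvd_zpow_conj_iff 1] at h₁ h₂
      rw [e, hc.1 _ (hS.zpow_conj_mem (-1) hcP) h₂ h₁]
      group
    have hhead : IsHead S (s⁻¹ * y * Δ) (s⁻¹ * Δ) := by
      rw [e]
      refine hS.isHead_mul (hS.compl_mem hs) hy' hw ?_
      simpa using hS.isHead_conj 1 hyu
    have := ih hs (fun v hv => hL v (by simp [hv]))
      (e ▸ mul_mem (mem_pos (hS.compl_mem hs)) hy') hc.2 hhead
    rw [show L.prod⁻¹ * (s⁻¹ * y * Δ) * Δ ^ (L.length : ℤ)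
      = (s :: L).prod⁻¹ * y * Δ ^ ((s :: L).length : ℤ) by
        rw [List.prod_cons, List.length_cons]; push_cast; group] at this
    rwa [List.getLast_cons_cons]

theorem leftWeighted_delta (t : G) : LeftWeighted S Δ Δ t := by
  intro c hc h _
  rw [inv_mul_cancel] at h
  exact hS.isLcmMonoid.eq_one_of_ldvd hc h

/-- The supremum of a nonempty product of consecutively left weighted simple elements
is the number of factors. -/
theorem isSup_prod {L : List G} (hne : L ≠ []) (hL : ∀ s ∈ L, s ∈ S)
    (hc : List.IsChain (LeftWeighted S Δ) L) (hlast : L.getLast hne ≠ 1) :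
    L.prod⁻¹ * Δ ^ (L.length : ℤ) ∈ pos S ∧ L.prod⁻¹ * Δ ^ ((L.length : ℤ) - 1) ∉ pos S := by
  -- The complement of `Δ` is `1`, so `Δ` may be prepended as a dummy factor.
  have hc' : List.IsChain (LeftWeighted S Δ) (Δ :: L) :=
    List.isChain_cons.2 ⟨fun t _ => hS.leftWeighted_delta t, hc⟩
  obtain ⟨h₁, h₂⟩ := hS.isHead_inv_mul hS.delta_mem_self hL (one_mem _) hc'
    (hS.isHead_one (by simp))
  rw [mul_one] at h₁ h₂
  rw [List.getLast_cons hne] at h₂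
  refine ⟨h₁, fun h => hlast ?_⟩
  -- A smaller supremum would make `Δ` divide an element whose head is the complement of the last
  -- factor, forcing that factor to be `1`.
  have := hS.eq_delta_of_isHead (hS.compl_mem (hL _ (List.getLast_mem hne))) h₂ (by
    rw [ldvd_iff]
    have := hS.conj_mem h
    rwa [show Δ⁻¹ * (L.prod⁻¹ * Δ ^ ((L.length : ℤ) - 1)) * Δ
      = Δ⁻¹ * (L.prod⁻¹ * Δ ^ (L.length : ℤ)) by group] at this)
  simpa using this

/-- If all powers of `b` have infimum at most linear with slope `p`, then no conjugate of `b`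
has infimum greater than `p`. -/
theorem le_of_isConj_of_pow {b b' : G} {p k : ℤ} (hbb' : IsConj b b')
    (hb : ∀ n : ℕ, Δ ^ (-(n * p + 1)) * b ^ n ∉ pos S) (hk : Δ ^ (-k) * b' ∈ pos S) :
    k ≤ p := by
  by_contra! hlt
  have hpow : ∀ n : ℕ, Δ ^ (-(n * k)) * b' ^ n ∈ pos S := by
    intro n
    induction n with
    | zero => simp
    | succ n ih =>
      have := mul_mem (hS.zpow_conj_mem k ih) hk
      rwa [show Δ ^ (-k) * (Δ ^ (-(n * k)) * b' ^ n) * Δ ^ k * (Δ ^ (-k) * b')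
        = Δ ^ (-((n + 1 : ℕ) * k)) * b' ^ (n + 1) by
          rw [pow_succ]
          push_cast
          rw [show -(((n : ℤ) + 1) * k) = -k + -(n * k) by ring, zpow_add]
          group] at this
  obtain ⟨c, rfl⟩ := isConj_iff.1 hbb'
  -- `M` and `N` bound the cost of conjugating by `c`, uniformly in `n`.
  obtain ⟨M, hM⟩ := hS.exists_zpow_mul_mem c
  obtain ⟨N, hN⟩ := hS.exists_zpow_mul_mem c⁻¹
  have key : ∀ n : ℕ, Δ ^ (-(n * k - M - N)) * b ^ n ∈ pos S := by
    intro n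
    have h₁ := hS.zpow_conj_mem (n * k - M) hN
    have := mul_mem h₁ (mul_mem (hS.zpow_conj_mem (-M) (hpow n)) hM)
    rwa [show Δ ^ (-((n : ℤ) * k - M)) * (Δ ^ (N : ℤ) * c⁻¹) * Δ ^ ((n : ℤ) * k - M) *
        (Δ ^ (-(-(M : ℤ))) * (Δ ^ (-((n : ℤ) * k)) * (c * b * c⁻¹) ^ n) * Δ ^ (-(M : ℤ)) *
          (Δ ^ (M : ℤ) * c)) = Δ ^ (-((n : ℤ) * k - M - N)) * b ^ n by
        rw [conj_pow, show -((n : ℤ) * k - M - N) = -((n : ℤ) * k - M) + N by ring, zpow_add,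
          show (n : ℤ) * k - M = -(-((n : ℤ) * k) + M) by ring, zpow_neg, zpow_neg, zpow_neg,
          zpow_neg, zpow_add]
        group] at this
  -- As `k ≥ p + 1`, this exponent gives `n * k - M - N ≥ n * p + 1`.
  refine hb (M + N + 1) (hS.zpow_neg_mul_mem_of_le ?_ (key (M + N + 1)))
  push_cast
  nlinarith

end IsGarsideSystem

/-! ### Normal forms and powers of rigid elements. -/

/-- A normal form `b = Δ ^ p * L.prod`, with the weightedness of consecutive factors. -/
structure IsWeightedForm (S : Set G) (Δ b : G) (p : ℤ) (L : List G) : Prop where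
  eq : b = Δ ^ p * L.prod
  mem : ∀ s ∈ L, s ∈ S
  chain : List.IsChain (LeftWeighted S Δ) L
  last : ∀ h : L ≠ [], L.getLast h ≠ 1
  not_mem : Δ⁻¹ * L.prod ∉ pos S

/-- If `c` divides both `s⁻¹ * Δ` and the next factor, then `s * c` divides `Δ` and the tail
starting at `s`, hence divides their gcd `s`. -/
theorem IsPositiveNormalForm.mem_and_chain (hS : IsGarsideSystem S Δ) {L : List G}
    (h : ∀ s t, (s :: t) <:+ L → IsLeftGcd (pos S) Δ (s :: t).prod s) :
    (∀ s ∈ L, s ∈ S) ∧ List.IsChain (LeftWeighted S Δ) L := by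
  induction L with
  | nil => simp
  | cons s L ih =>
    obtain ⟨h₁, h₂⟩ := ih fun u t hut => h u t (hut.trans (List.suffix_cons s L))
    obtain ⟨hs, hsΔ, hsL, hmax⟩ := h s L List.suffix_rfl
    have hsS : s ∈ S := hS.mem_iff_left.2 ⟨hs, ldvd_iff.1 hsΔ⟩
    refine ⟨by simpa using ⟨hsS, h₁⟩, List.isChain_cons.2 ⟨fun t ht c hc hcs hct => ?_, h₂⟩⟩
    obtain ⟨T, rfl⟩ : ∃ T, L = t :: T := by
      cases L with
      | nil => simp at ht
      | cons a T => exact ⟨T, by simpa using ht⟩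
    have h₃ : LDvd (pos S) (s * c) s := by
      refine hmax _ (mul_mem hs hc) ?_ ?_
      · rw [← ldvd_mul_left_iff (c := s), mul_inv_cancel_left] at hcs
        exact hcs
      · rw [List.prod_cons, ldvd_mul_left_iff, List.prod_cons]
        refine ldvd_trans hct ⟨T.prod, ?_, rfl⟩
        exact prod_mem_pos fun v hv => h₁ v (by simp [hv])
    refine hS.isLcmMonoid.eq_one_of_ldvd hc ?_
    rwa [← ldvd_mul_left_iff (c := s), mul_one]

theorem IsLeftNormalForm.isWeightedForm (hS : IsGarsideSystem S Δ) {b : G} {p : ℤ} {L : List G}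
    (hb : IsLeftNormalForm S Δ b p L) : IsWeightedForm S Δ b p L := by
  obtain ⟨hinf, rfl, hnf, hlast⟩ := hb
  obtain ⟨h₁, h₂⟩ := IsPositiveNormalForm.mem_and_chain hS hnf
  refine ⟨rfl, h₁, h₂, hlast, fun h => ?_⟩
  have := hinf.2 (show Le (pos S) (Δ ^ (p + 1)) (Δ ^ p * L.prod) from
    hS.le_zpow_left_iff.2 (by
      rwa [show Δ ^ (-(p + 1)) * (Δ ^ p * L.prod) = Δ⁻¹ * L.prod by group]))
  omega

namespace IsWeightedForm

variable {b : G} {p : ℤ} {L : List G}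

theorem isInf (hS : IsGarsideSystem S Δ) (hb : IsWeightedForm S Δ b p L) : IsInf S Δ b p := by
  refine hS.isInf_of ?_ ?_
  · rw [hb.eq, show Δ ^ (-p) * (Δ ^ p * L.prod) = L.prod by group]
    exact prod_mem_pos hb.mem
  · rw [hb.eq, show Δ ^ (-(p + 1)) * (Δ ^ p * L.prod) = Δ⁻¹ * L.prod by group]
    exact hb.not_mem

theorem isSup (hS : IsGarsideSystem S Δ) (hb : IsWeightedForm S Δ b p L) (hL : L ≠ []) :
    IsSup S Δ b (p + L.length) := by
  obtain ⟨h₁, h₂⟩ := hS.isSup_prod hL hb.mem hb.chain (hb.last hL)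
  refine hS.isSup_of ?_ ?_
  · rwa [hb.eq, show (Δ ^ p * L.prod)⁻¹ * Δ ^ (p + L.length)
      = L.prod⁻¹ * Δ ^ (L.length : ℤ) by group]
  · rwa [hb.eq, show (Δ ^ p * L.prod)⁻¹ * Δ ^ (p + L.length - 1)
      = L.prod⁻¹ * Δ ^ ((L.length : ℤ) - 1) by group]

/-- By rigidity, prepending one more copy of `b` keeps the head inside `τ ^ (-p) (s)`. An extra `Δ`
would force `s = Δ`, against the maximality of `p`. -/
theorem pow_inf (hS : IsGarsideSystem S Δ) {s : G} {T : List G}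
    (hb : IsWeightedForm S Δ b p (s :: T))
    (hr : LeftWeighted S Δ ((s :: T).getLast (List.cons_ne_nil _ _)) (Δ ^ p * s * Δ ^ (-p)))
    (n : ℕ) : Δ ^ (-(n * p + 1)) * b ^ n ∉ pos S := by
  have hs := hb.mem s (by simp)
  have hs' : Δ ^ p * s * Δ ^ (-p) ∈ S := by simpa using hS.zpow_conj_mem_self (-p) hs
  have key : ∀ n : ℕ, b ^ n * Δ ^ (-(n * p)) ∈ pos S ∧
      IsHead S (b ^ n * Δ ^ (-(n * p))) (Δ ^ p * s * Δ ^ (-p)) := by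
    intro n
    induction n with
    | zero => simpa using hS.isHead_one (mem_pos hs')
    | succ n ih =>
      have hc : List.IsChain (LeftWeighted S Δ) (s :: T ++ [Δ ^ p * s * Δ ^ (-p)]) := by
        refine List.isChain_append.2 ⟨hb.chain, by simp, ?_⟩
        intro x hx y hy
        rw [List.getLast?_eq_some_getLast (List.cons_ne_nil _ _)] at hx
        simp only [Option.mem_def, Option.some.injEq, List.head?_cons] at hx hy
        rwa [← hx, ← hy]
      have e : b ^ (n + 1) * Δ ^ (-((n + 1 : ℕ) * p))
          = Δ ^ (- -p) * ((s :: T).prod * (b ^ n * Δ ^ (-(n * p)))) * Δ ^ (-p) := by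
        rw [pow_succ']
        nth_rw 1 [hb.eq]
        push_cast
        rw [show -(((n : ℤ) + 1) * p) = -(n * p) + -p by ring, zpow_add]
        group
      rw [e]
      refine ⟨hS.zpow_conj_mem (-p) (mul_mem (prod_mem_pos hb.mem) ih.1), ?_⟩
      have := hS.isHead_conj (-p) (hS.isHead_prod_mul hb.mem ih.1 hc ih.2)
      rwa [neg_neg] at this ⊢
  intro h
  have h₁ := hS.eq_delta_of_isHead hs' (key n).2 (by
    rw [ldvd_iff]
    have := hS.zpow_conj_mem (-(n * p)) h
    rwa [show Δ ^ (-(-((n : ℤ) * p))) * (Δ ^ (-(n * p + 1)) * b ^ n) * Δ ^ (-((n : ℤ) * p))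
      = Δ⁻¹ * (b ^ n * Δ ^ (-((n : ℤ) * p))) by
        rw [show -((n : ℤ) * p + 1) = -(n * p) + -1 by ring, zpow_add]
        group] at this)
  have h₂ : s = Δ := by
    rw [show s = Δ ^ (-p) * (Δ ^ p * s * Δ ^ (-p)) * Δ ^ p by group, h₁]
    group
  apply hb.not_mem
  rw [List.prod_cons, h₂, inv_mul_cancel_left]
  exact prod_mem_pos fun v hv => hb.mem v (by simp [hv])

/-- The counterpart of `pow_inf` for `b⁻¹`: the head stays inside `z⁻¹ * Δ`, and an extra `Δ` would
force the last factor `z` to be `1`. -/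
theorem pow_sup (hS : IsGarsideSystem S Δ) {s : G} {T : List G}
    (hb : IsWeightedForm S Δ b p (s :: T))
    (hr : LeftWeighted S Δ ((s :: T).getLast (List.cons_ne_nil _ _)) (Δ ^ p * s * Δ ^ (-p)))
    (n : ℕ) :
    Δ ^ (-(n * -(p + (s :: T).length) + 1)) * b⁻¹ ^ n ∉ pos S := by
  set z := (s :: T).getLast (List.cons_ne_nil _ _) with hz
  set q : ℤ := p + (s :: T).length with hq
  have hzS : z ∈ S := hb.mem z (List.getLast_mem _)
  have hc : List.IsChain (LeftWeighted S Δ) (Δ ^ (-p) * z * Δ ^ p :: s :: T) := by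
    refine List.isChain_cons_cons.2 ⟨?_, hb.chain⟩
    have := hS.leftWeighted_conj p hr
    rwa [show Δ ^ (-p) * (Δ ^ p * s * Δ ^ (-p)) * Δ ^ p = s by group] at this
  have key : ∀ n : ℕ, b⁻¹ ^ n * Δ ^ (n * q) ∈ pos S ∧
      IsHead S (b⁻¹ ^ n * Δ ^ (n * q)) (z⁻¹ * Δ) := by
    intro n
    induction n with
    | zero => simpa using hS.isHead_one (mem_pos (hS.compl_mem hzS))
    | succ n ih =>
      have h := hS.isHead_conj p ih.2
      rw [show Δ ^ (-p) * (z⁻¹ * Δ) * Δ ^ p = (Δ ^ (-p) * z * Δ ^ p)⁻¹ * Δ by group] at h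
      have := hS.isHead_inv_mul (hS.zpow_conj_mem_self p hzS) hb.mem
        (hS.zpow_conj_mem p ih.1) hc h
      rw [List.getLast_cons_cons, ← hz] at this
      rwa [show (s :: T).prod⁻¹ * (Δ ^ (-p) * (b⁻¹ ^ n * Δ ^ (n * q)) * Δ ^ p) *
          Δ ^ ((s :: T).length : ℤ) = b⁻¹ ^ (n + 1) * Δ ^ ((n + 1 : ℕ) * q) by
        rw [pow_succ' b⁻¹ n]
        nth_rw 2 [hb.eq]
        push_cast
        rw [show ((n : ℤ) + 1) * q = n * q + (p + (s :: T).length) by rw [hq]; ring, zpow_add,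
          zpow_add]
        simp only [mul_inv_rev, zpow_neg, mul_assoc]] at this
  intro h
  apply hb.last (List.cons_ne_nil _ _)
  have h₁ := hS.eq_delta_of_isHead (hS.compl_mem hzS) (key n).2 (by
    rw [ldvd_iff]
    have := hS.zpow_conj_mem (n * q) h
    rwa [show Δ ^ (-((n : ℤ) * q)) * (Δ ^ (-(n * -q + 1)) * b⁻¹ ^ n) * Δ ^ ((n : ℤ) * q)
      = Δ⁻¹ * (b⁻¹ ^ n * Δ ^ ((n : ℤ) * q)) by
        rw [show -((n : ℤ) * -q + 1) = n * q + -1 by ring, zpow_add, zpow_neg]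
        group] at this)
  simpa using h₁

/-- The last factor of a normal form with at least two factors is preceded by a nontrivial
factor. -/
theorem last_dropLast_ne_one {M : List G} {z : G} (hS : IsGarsideSystem S Δ)
    (hb : IsWeightedForm S Δ b p (M ++ [z])) (hM : M ≠ []) : M.getLast hM ≠ 1 := by
  intro h
  have hw := (List.isChain_append.1 hb.chain).2.2 _ (List.getLast?_eq_some_getLast hM) z (by simp)
  have hzS := hb.mem z (by simp)
  refine hb.last (by simp) ?_
  rw [List.getLast_append_singleton]
  -- The complement of `1` is `Δ`, which every simple element divides.
  refine hw z (mem_pos hzS) ?_ (ldvd_iff.2 (by simp))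
  rw [h, inv_one, one_mul, ldvd_iff]
  exact (hS.mem_iff_left.1 hzS).2

end IsWeightedForm

/-! ### Rigidity, super summit sets and decycling. -/

theorem isRigid_iff (hS : IsGarsideSystem S Δ) {p : ℤ} {L : List G} (hL : L ≠ [])
    (hmem : ∀ s ∈ L, s ∈ S) :
    IsRigid S Δ p L hL ↔
      LeftWeighted S Δ (L.getLast hL) (Δ ^ p * L.head hL * Δ ^ (-p)) := by
  have hz := hmem _ (List.getLast_mem hL)
  have hs : Δ ^ p * L.head hL * Δ ^ (-p) ∈ S := by
    simpa using hS.zpow_conj_mem_self (-p) (hmem _ (List.head_mem hL))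
  rw [IsRigid, hS.partialMap_eq hz, tau_zpow_apply, neg_neg]
  constructor
  · rintro ⟨-, -, -, h⟩ c hc h₁ h₂
    exact hS.isLcmMonoid.eq_one_of_ldvd hc (h c hc h₂ h₁)
  · refine fun h => ⟨one_mem _, ?_, ?_, fun c hc h₁ h₂ => ?_⟩
    · exact ldvd_iff.2 (by simpa using mem_pos hs)
    · exact ldvd_iff.2 (by simpa using mem_pos (hS.compl_mem hz))
    · rw [h c hc h₂ h₁]
      exact ldvd_iff.2 (by simp)

/-- This is where spindle type enters: a gcd of two simple elements other than `1` is one of them.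
-/
theorem IsSpindle.ldvd_or_of_not_isRigid (hS : IsSpindle S Δ) {p : ℤ} {L : List G}
    (hL : L ≠ []) (hmem : ∀ s ∈ L, s ∈ S) (h : ¬ IsRigid S Δ p L hL) :
    LDvd (pos S) (Δ ^ p * L.head hL * Δ ^ (-p)) ((L.getLast hL)⁻¹ * Δ) ∨
      LDvd (pos S) ((L.getLast hL)⁻¹ * Δ) (Δ ^ p * L.head hL * Δ ^ (-p)) := by
  have hG := hS.toIsGarsideSystem
  have hz := hmem _ (List.getLast_mem hL)
  have hs : Δ ^ p * L.head hL * Δ ^ (-p) ∈ S := by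
    simpa using hG.zpow_conj_mem_self (-p) (hmem _ (List.head_mem hL))
  obtain ⟨d, hd⟩ := hG.exists_leftGcd hs (hG.compl_mem hz)
  rcases hS.leftGcd _ hs _ (hG.compl_mem hz) d hd with rfl | rfl | rfl
  · exact Or.inl hd.2.2.1
  · exact Or.inr hd.2.1
  · refine absurd ?_ h
    rwa [IsRigid, hG.partialMap_eq hz, tau_zpow_apply, neg_neg]

theorem mem_superSummitSet_of_isRigid (hS : IsGarsideSystem S Δ) {b : G} {p : ℤ} {L : List G}
    (hL : L ≠ []) (hb : IsWeightedForm S Δ b p L) (hr : IsRigid S Δ p L hL) :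
    b ∈ superSummitSet S Δ b := by
  rw [isRigid_iff hS hL hb.mem] at hr
  have hinf := hb.isInf hS
  have hsup := hb.isSup hS hL
  obtain ⟨s, T, rfl⟩ := List.exists_cons_of_ne_nil hL
  refine ⟨IsConj.refl b, p, p + (s :: T).length, ⟨⟨b, IsConj.refl b, hinf⟩, ?_⟩,
    ⟨⟨b, IsConj.refl b, hsup⟩, ?_⟩, ?_, ?_⟩
  · rintro k ⟨b', hbb', hk⟩
    exact hS.le_of_isConj_of_pow hbb' (hb.pow_inf hS hr) (hS.le_zpow_left_iff.1 hk.1)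
  · rintro k ⟨b', hbb', hk⟩
    -- The supremum of an element is minus the infimum of its inverse.
    have hconj : IsConj b⁻¹ b'⁻¹ := by
      obtain ⟨c, rfl⟩ := isConj_iff.1 hbb'
      exact isConj_iff.2 ⟨c, by group⟩
    have hk' := hS.zpow_conj_mem (-k) (hS.le_zpow_right_iff.1 hk.1)
    rw [show Δ ^ (- -k) * (b'⁻¹ * Δ ^ k) * Δ ^ (-k) = Δ ^ (- -k) * b'⁻¹ by group] at hk'
    have := hS.le_of_isConj_of_pow hconj (hb.pow_sup hS hr) hk'
    omega
  · rw [ldvd_iff, ← zpow_neg]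
    exact hS.le_zpow_left_iff.1 hinf.1
  · rw [ldvd_iff]
    exact hS.le_zpow_right_iff.1 hsup.1

theorem decycle_eq_conj {b : G} {p : ℤ} {L : List G} (hL : L ≠ []) (hb : b = Δ ^ p * L.prod) :
    decycle Δ p L hL = L.getLast hL * b * (L.getLast hL)⁻¹ := by
  have h : L.prod = L.dropLast.prod * L.getLast hL := by
    nth_rw 1 [← List.dropLast_append_getLast hL]
    simp
  rw [decycle, tau_zpow_apply, hb, h]
  group

/-- Decycling brings `z` next to `τ ^ (-p) (s)`. If the latter divides `z⁻¹ * Δ`, the two merge into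
one simple factor; if it is a multiple of `z⁻¹ * Δ`, they release a `Δ`. -/
theorem inf_or_sup_decycle (hS : IsSpindle S Δ) {b : G} {p : ℤ} {L : List G}
    (hL : L ≠ []) (hb : IsWeightedForm S Δ b p L) (hlen : 2 ≤ L.length)
    (hr : ¬ IsRigid S Δ p L hL) :
    IsInf S Δ (decycle Δ p L hL) (p + 1) ∨
      IsSup S Δ (decycle Δ p L hL) (p + L.length - 1) := by
  have hG := hS.toIsGarsideSystem
  have hcases := hS.ldvd_or_of_not_isRigid hL hb.mem hr
  obtain ⟨s, T, rfl⟩ := List.exists_cons_of_ne_nil hL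
  obtain ⟨M, z, rfl⟩ : ∃ M z, T = M ++ [z] :=
    ⟨T.dropLast, T.getLast (by rintro rfl; simp at hlen),
      (List.dropLast_append_getLast _).symm⟩
  have hsM : ∀ u ∈ s :: M, u ∈ S := fun u hu => hb.mem u (List.mem_append_left [z] hu)
  have hM : ∀ u ∈ M, u ∈ S := fun u hu => hsM u (List.mem_cons_of_mem _ hu)
  have hzS : z ∈ S := hb.mem z (by simp)
  have hdec : decycle Δ p (s :: (M ++ [z])) hL = z * Δ ^ p * (s :: M).prod := by
    rw [decycle_eq_conj hL hb.eq, hb.eq]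
    simp [mul_assoc]
  have hlast : (s :: (M ++ [z])).getLast hL = z := by simp
  rw [hlast, List.head_cons] at hcases
  rw [hdec]
  rcases hcases with h | h
  · right
    have hsup := hG.isSup_prod (List.cons_ne_nil s M) hsM
      (List.isChain_append (l₁ := s :: M).1 hb.chain).1
      (IsWeightedForm.last_dropLast_ne_one (M := s :: M) hG hb (List.cons_ne_nil s M))
    have hlen' : p + ((s :: (M ++ [z])).length : ℤ) - 1 = p + (M.length + 1) := by
      simp only [List.length_cons, List.length_append, List.length_nil]
      push_cast
      ring
    rw [hlen']
    rw [ldvd_iff] at h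
    refine hG.isSup_of ?_ fun h' => hsup.2 ?_
    · have hMl : M.prod⁻¹ * Δ ^ (M.length : ℤ) ∈ pos S := by
        -- A product of `n` simple elements divides `Δ ^ n`.
        have : ∀ N : List G, (∀ u ∈ N, u ∈ S) → N.prod⁻¹ * Δ ^ (N.length : ℤ) ∈ pos S := by
          intro N hN
          induction N with
          | nil => simp
          | cons u N ih =>
            have h₁ := mul_mem (ih fun v hv => hN v (by simp [hv]))
              (hG.zpow_conj_mem N.length (hG.mem_iff_left.1 (hN u (by simp))).2)
            rwa [show N.prod⁻¹ * Δ ^ (N.length : ℤ) *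
                (Δ ^ (-(N.length : ℤ)) * (u⁻¹ * Δ) * Δ ^ (N.length : ℤ))
              = (u :: N).prod⁻¹ * Δ ^ ((u :: N).length : ℤ) by
                rw [List.prod_cons, List.length_cons]; push_cast; group] at h₁
        exact this M hM
      have := mul_mem hMl (hG.zpow_conj_mem (p + M.length) h)
      rwa [show M.prod⁻¹ * Δ ^ (M.length : ℤ) * (Δ ^ (-(p + M.length)) *
          ((Δ ^ p * s * Δ ^ (-p))⁻¹ * (z⁻¹ * Δ)) * Δ ^ (p + M.length))
        = (z * Δ ^ p * (s :: M).prod)⁻¹ * Δ ^ (p + (M.length + 1)) by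
          rw [List.prod_cons]; group] at this
    -- A further drop would, after removing `z`, contradict the supremum of `(s :: M).prod`, whose
    -- last factor is nontrivial.
    · have := mul_mem h' (hG.zpow_conj_mem (p + M.length) (mem_pos hzS))
      rwa [show (z * Δ ^ p * (s :: M).prod)⁻¹ * Δ ^ (p + ((M.length : ℤ) + 1) - 1) *
          (Δ ^ (-(p + M.length)) * z * Δ ^ (p + M.length))
        = (s :: M).prod⁻¹ * Δ ^ (((s :: M).length : ℤ) - 1) by
          rw [List.length_cons]; push_cast; group] at this
  · left
    rw [ldvd_iff] at h
    refine hG.isInf_of ?_ fun h' => hb.not_mem ?_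
    · have := mul_mem (hG.zpow_conj_mem p h) (prod_mem_pos hM)
      rwa [show Δ ^ (-p) * ((z⁻¹ * Δ)⁻¹ * (Δ ^ p * s * Δ ^ (-p))) * Δ ^ p * M.prod
        = Δ ^ (-(p + 1)) * (z * Δ ^ p * (s :: M).prod) by
          rw [List.prod_cons]; group] at this
    -- Conjugating back by the simple element `z` loses at most one `Δ`, so infimum `p + 2` or more
    -- would give `b` infimum above `p`.
    · have h₁ := hG.zpow_conj_mem (p + 1 + 1) (mem_pos (hG.leftCompl_mem hzS))
      have := mul_mem (mul_mem h₁ h') (mem_pos hzS)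
      rwa [show Δ ^ (-(p + 1 + 1)) * (Δ * z⁻¹) * Δ ^ (p + 1 + 1) *
          (Δ ^ (-(p + 1 + 1)) * (z * Δ ^ p * (s :: M).prod)) * z
        = Δ ^ (-(p + 1)) * Δ ^ p * ((s :: M).prod * z) by group,
        show Δ ^ (-(p + 1)) * Δ ^ p = Δ⁻¹ by group,
        show (s :: M).prod * z = (s :: (M ++ [z])).prod by simp [mul_assoc]] at this

end Garside

theorem mainTheorem6 {G : Type*} [Group G] (S : Set G) (Δ : G)
    (hS : Garside.IsSpindle S Δ) (b : G) (p : ℤ) (L : List G) (hL : L ≠ [])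
    (hb : Garside.IsLeftNormalForm S Δ b p L) :
    (Garside.IsRigid S Δ p L hL → b ∈ Garside.superSummitSet S Δ b) ∧
    (2 ≤ L.length →
      (b ∈ Garside.superSummitSet S Δ b ↔ Garside.IsRigid S Δ p L hL) ∧
      (¬ Garside.IsRigid S Δ p L hL →
        (∃ r : ℤ, Garside.IsInf S Δ b r ∧
          Garside.IsInf S Δ (Garside.decycle Δ p L hL) (r + 1)) ∨
        (∃ r : ℤ, Garside.IsSup S Δ b r ∧
          Garside.IsSup S Δ (Garside.decycle Δ p L hL) (r - 1)))) := by
  have hG := hS.toIsGarsideSystem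
  have hw := hb.isWeightedForm hG
  have hrigid := Garside.mem_superSummitSet_of_isRigid hG hL hw
  have hinf := hw.isInf hG
  have hsup := hw.isSup hG hL
  refine ⟨hrigid, fun hlen => ⟨⟨?_, hrigid⟩, fun hr => ?_⟩⟩
  · rintro ⟨-, r, s, hr, hs, hrb, hbs⟩
    by_contra hnot
    have hconj : IsConj b (Garside.decycle Δ p L hL) :=
      isConj_iff.2 ⟨_, (Garside.decycle_eq_conj hL hw.eq).symm⟩
    rw [Garside.ldvd_iff] at hrb hbs
    rcases Garside.inf_or_sup_decycle hS hL hw hlen hnot with h | h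
    · have h₁ : p + 1 ≤ r := hr.2 ⟨_, hconj, h⟩
      have h₂ : r ≤ p := hinf.2 (hG.le_zpow_left_iff.2 (by rwa [zpow_neg]))
      omega
    · have h₁ : s ≤ p + L.length - 1 := hs.2 ⟨_, hconj, h⟩
      have h₂ : p + L.length ≤ s := hsup.2 (hG.le_zpow_right_iff.2 hbs)
      omega
  · rcases Garside.inf_or_sup_decycle hS hL hw hlen hr with h | h
    · exact Or.inl ⟨p, hinf, h⟩
    · exact Or.inr ⟨p + L.length, hsup, h⟩
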